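/- A Hausdorff topological space $X$ is called Stäckel-compact if there is a linear order $\prec$ on $X$ (not assumed to be related to the topology) such that every non-empty closed subset of $X$ has a least and a greatest element with respect to $\prec$. Let $\beta(\mathbb{N})$ be the Stone–Čech compactification of the discrete space $\mathbb{N}$ of positive integers. A subspace $X$ of $\beta(\mathbb{N})$ is called a basic Novák space if $X=\bigcup_{\xi<\omega_1}X_\xi$ for some sequence $\langle X_\xi\rangle_{\xi<\omega_1}$ such that for all $\xi<\omega_1$: $\aleph_0\le |X_\xi|\le 2^{\aleph_0}$; $X_\xi$ is disjoint from $\bigcup_{\mu<\xi}X_\mu$; and every infinite subset of $\bigcup_{\mu<\xi}X_\mu$ has a limit point in $X_\xi$. There exist basic Novák spaces $Y, Z\subseteq\beta(\mathbb{N})$ such that $Y$ and $Z$ (with the subspace topologies) are Stäckel-compact but the product space $Y\times Z$ is not countably compact. Moreover $Y\times Z$ is not Stäckel-compact, so Stäckel-compactness is not a productive property. -/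

import Mathlib

open scoped Cardinal Ordinal

/-- A linear order on a topological space is a *symmetric topological well-order* if each
non-empty closed subset has a least and a greatest element. The order is not related to the
topology in any other way. -/
def IsSymmetricTopologicalWellOrder {X : Type*} [TopologicalSpace X] (o : LinearOrder X) : Prop :=
  ∀ C : Set X, IsClosed C → C.Nonempty →
    (∃ a ∈ C, ∀ x ∈ C, o.le a x) ∧ (∃ b ∈ C, ∀ x ∈ C, o.le x b)

/-- A *Stäckel-compact* space is a Hausdorff space admitting a symmetric topological
well-order. -/
def StackelCompact (X : Type*) [TopologicalSpace X] : Prop :=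
  T2Space X ∧ ∃ o : LinearOrder X, IsSymmetricTopologicalWellOrder o

/-- A subspace `S` of the Stone-Čech compactification of the discrete space of positive integers
is a *basic Novák space* if it is the union of a sequence `X` of length `ω₁` (values of `X` at
ordinals `≥ ω₁` play no role) of pairwise disjoint sets, each of cardinality between `ℵ₀` and the
continuum, such that every infinite subset of `⋃ μ < ξ, X μ` has a limit point in `X ξ`. -/
def IsBasicNovakSpace (S : Set (StoneCech ℕ+)) : Prop :=
  ∃ X : Ordinal.{0} → Set (StoneCech ℕ+),
    S = ⋃ ξ < ω_ 1, X ξ ∧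
    ∀ ξ < ω_ 1,
      ℵ₀ ≤ #(X ξ) ∧ #(X ξ) ≤ 2 ^ ℵ₀ ∧
      Disjoint (X ξ) (⋃ μ < ξ, X μ) ∧
      ∀ A ⊆ ⋃ μ < ξ, X μ, A.Infinite → ∃ x ∈ X ξ, AccPt x (Filter.principal A)

open Set Topology Filter

/-! An infinite closed subset of a basic Novák space contains a sequence, which lies below some
level `ζ < ω₁`, so the set meets every later level. Splitting the levels into limit and non-limit
ones gives two pieces that every infinite closed set meets. Well-order one piece and put the other
above it in reverse: infinite closed sets have extrema in these pieces, finite sets trivially.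

For the product, `Y` and `Z` are built by a joint recursion so that they share only the points of
`ℕ+`, which are isolated. The diagonal is then infinite and all its subsets are closed in `Y × Z`,
which rules out both compactness properties. The recursion never runs out of points: an infinite
subset of the Stone-Čech compactification has more than `𝔠` accumulation points
(`Set.Infinite.continuum_lt_mk_derivedSet_stoneCech`), while each step serves at most `𝔠` sequences
and avoids at most `𝔠` points. -/

/-! ### Accumulation points in Stone-Čech compactifications -/

/-- A power of the two-point space with continuum many factors is separable. -/
theorem exists_denseRange_nat_set_bool : ∃ h : ℕ → (Set ℕ → Bool), DenseRange h := by
  classical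
  let e : Finset ℕ × Finset (Finset ℕ) → (Set ℕ → Bool) :=
    fun p A => decide (p.1.filter (· ∈ A) ∈ p.2)
  obtain ⟨φ, hφ⟩ := exists_surjective_nat (Finset ℕ × Finset (Finset ℕ))
  refine ⟨e ∘ φ, ?_⟩
  suffices H : DenseRange e by rwa [DenseRange, hφ.range_comp]
  rw [DenseRange, dense_iff_inter_open]
  rintro U hU ⟨f, hf⟩
  obtain ⟨I, u, hu, hIU⟩ := isOpen_pi_iff.1 hU f hf
  have hsep : ∀ A B : Set ℕ, ∃ k, A ≠ B → ¬ (k ∈ A ↔ k ∈ B) := by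
    intro A B
    by_cases h : A = B
    · exact ⟨0, fun h' => (h' h).elim⟩
    · by_contra! hcon
      exact h (Set.ext fun k => (hcon k).2)
  choose k hk using hsep
  -- One separating point per pair, so distinct members of `I` have distinct traces on `F`.
  let F : Finset ℕ := (I ×ˢ I).image fun p => k p.1 p.2
  let T : Finset (Finset ℕ) := (I.filter (f · = true)).image fun A => F.filter (· ∈ A)
  refine ⟨e (F, T), hIU ?_, mem_range_self _⟩
  intro A hA
  suffices e (F, T) A = f A by rw [this]; exact (hu A hA).2
  have key : F.filter (· ∈ A) ∈ T ↔ f A = true := by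
    simp only [T, Finset.mem_image, Finset.mem_filter]
    constructor
    · rintro ⟨B, ⟨hB, hfB⟩, hBA⟩
      by_cases h : A = B
      · rwa [h]
      · refine (hk A B h ?_).elim
        have hF : k A B ∈ F := Finset.mem_image.2 ⟨(A, B), Finset.mk_mem_product hA hB, rfl⟩
        have := Finset.ext_iff.1 hBA (k A B)
        simp only [Finset.mem_filter, hF, true_and] at this
        exact this.symm
    · intro h
      exact ⟨A, ⟨hA, h⟩, rfl⟩
  simp only [e]
  rw [Bool.eq_iff_iff, decide_eq_true_iff, key]

/-- An infinite subset of a regular Hausdorff space contains a sequence of points with pairwise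
disjoint open neighbourhoods. -/
theorem Set.Infinite.exists_seq_isOpen_pairwise_disjoint {X : Type*} [TopologicalSpace X]
    [T3Space X] {A : Set X} (hA : A.Infinite) :
    ∃ (d : ℕ → X) (U : ℕ → Set X), (∀ n, d n ∈ A) ∧ (∀ n, IsOpen (U n)) ∧ (∀ n, d n ∈ U n) ∧
      Pairwise (Function.onFun Disjoint U) := by
  have := hA.to_subtype
  obtain ⟨V, hVi, hVo, hVd⟩ := exists_seq_infinite_isOpen_pairwise_disjoint A
  choose a ha using fun n => (hVi n).nonempty
  choose W hWo hWV using fun n => isOpen_induced_iff.1 (hVo n)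
  have haW : ∀ n, (a n : X) ∈ W n := fun n => by
    have := ha n
    rwa [← hWV n] at this
  -- The `W n` are disjoint only within `A`. As `C j` misses `a n` for `j ≠ n`, removing the earlier
  -- `C j` from `interior (C n)` leaves a neighbourhood of `a n`.
  choose C hC hCc hCW using fun n => exists_mem_nhds_isClosed_subset ((hWo n).mem_nhds (haW n))
  have hne : ∀ m n, m ≠ n → (a n : X) ∉ C m := by
    intro m n hmn h
    have h1 : a n ∈ V m := by rw [← hWV m]; exact hCW m h
    exact disjoint_left.1 (hVd hmn) h1 (ha n)
  have hdisj : ∀ m n, m < n → Disjoint (interior (C m) \ ⋃ j ∈ Finset.range m, C j)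
      (interior (C n) \ ⋃ j ∈ Finset.range n, C j) := by
    intro m n h
    refine disjoint_left.2 fun x hx hx' => hx'.2 ?_
    exact mem_biUnion (Finset.mem_coe.2 (Finset.mem_range.2 h)) (interior_subset hx.1)
  refine ⟨fun n => a n, fun n => interior (C n) \ ⋃ j ∈ Finset.range n, C j, fun n => (a n).2,
    fun n => isOpen_interior.sdiff (isClosed_biUnion_finset fun j _ => hCc j), fun n => ⟨?_, ?_⟩, ?_⟩
  · exact mem_interior_iff_mem_nhds.2 (hC n)
  · simp only [Finset.mem_range, mem_iUnion, not_exists]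
    exact fun j hj => hne j n hj.ne
  · intro m n hmn
    rcases hmn.lt_or_gt with h | h
    · exact hdisj m n h
    · exact (hdisj n m h).symm

/-- The closure of an infinite subset of the Stone-Čech compactification of a discrete space maps
onto every separable compact Hausdorff space. -/
theorem Set.Infinite.exists_closure_surjOn_stoneCech {α : Type*} [TopologicalSpace α]
    [DiscreteTopology α] {K : Type*} [TopologicalSpace K] [CompactSpace K] [T2Space K]
    {A : Set (StoneCech α)} (hA : A.Infinite) {h : ℕ → K} (hh : DenseRange h) :
    ∃ D ⊆ A, D.Countable ∧ ∃ G : StoneCech α → K, SurjOn G (closure D) univ := by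
  classical
  obtain ⟨d, U, hdA, hUo, hdU, hUd⟩ := hA.exists_seq_isOpen_pairwise_disjoint
  -- Disjointness of the `U n` makes the index unique; the value `h 0` elsewhere is arbitrary.
  let g : α → K := fun k => if hk : ∃ n, stoneCechUnit k ∈ U n then h hk.choose else h 0
  have hg : Continuous g := continuous_of_discreteTopology
  have hGc := continuous_stoneCechExtend hg
  have hgU : ∀ n k, stoneCechUnit k ∈ U n → g k = h n := by
    intro n k hk
    have hex : ∃ n, stoneCechUnit k ∈ U n := ⟨n, hk⟩
    have : hex.choose = n := hUd.eq (not_disjoint_iff.2 ⟨_, hex.choose_spec, hk⟩)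
    simp only [g, dif_pos hex, this]
  have hGd : ∀ n, stoneCechExtend hg (d n) = h n := by
    intro n
    have hcl : d n ∈ closure (U n ∩ range stoneCechUnit) :=
      denseRange_stoneCechUnit.open_subset_closure_inter (hUo n) (hdU n)
    have hcl' : closure (U n ∩ range stoneCechUnit) ⊆ {x | stoneCechExtend hg x = h n} := by
      refine closure_minimal ?_ (isClosed_eq hGc continuous_const)
      rintro _ ⟨hx, k, rfl⟩
      simp [hgU n k hx]
    exact hcl' hcl
  refine ⟨range d, range_subset_iff.2 hdA, countable_range d, stoneCechExtend hg, ?_⟩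
  have hclosed : IsClosed (stoneCechExtend hg '' closure (range d)) :=
    (isClosed_closure.isCompact.image hGc).isClosed
  have hsub : range h ⊆ stoneCechExtend hg '' closure (range d) := by
    rintro _ ⟨n, rfl⟩
    exact ⟨d n, subset_closure (mem_range_self n), hGd n⟩
  exact fun x _ => closure_minimal hsub hclosed (hh x)

/-- An infinite subset of the Stone-Čech compactification of a discrete space has more than
continuum many accumulation points. -/
theorem Set.Infinite.continuum_lt_mk_derivedSet_stoneCech {α : Type} [TopologicalSpace α]
    [DiscreteTopology α] {A : Set (StoneCech α)} (hA : A.Infinite) : 𝔠 < #(derivedSet A) := by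
  obtain ⟨h, hh⟩ := exists_denseRange_nat_set_bool
  obtain ⟨D, hDA, hDc, G, hG⟩ := hA.exists_closure_surjOn_stoneCech hh
  have h1 : 𝔠 < #(closure D) := by
    have hs : Function.Surjective fun x : closure D => G x := fun y => by
      obtain ⟨x, hx, rfl⟩ := hG (mem_univ y)
      exact ⟨⟨x, hx⟩, rfl⟩
    refine lt_of_lt_of_le ?_ (Cardinal.mk_le_of_surjective hs)
    simp only [Cardinal.mk_pi, Cardinal.prod_const, Cardinal.mk_bool, Cardinal.mk_set,
      Cardinal.mk_nat, Cardinal.lift_id]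
    exact Cardinal.cantor _
  by_contra! hle
  refine h1.not_ge ?_
  rw [closure_eq_self_union_derivedSet]
  refine (Cardinal.mk_union_le _ _).trans (Cardinal.add_le_of_le Cardinal.aleph0_le_continuum ?_ ?_)
  · exact hDc.le_aleph0.trans Cardinal.aleph0_le_continuum
  · exact (Cardinal.mk_le_mk_of_subset (derivedSet_mono _ _ hDA)).trans hle

/-! ### One step of the Novák recursion -/

/-- The successor step in the construction of a basic Novák space. -/
theorem exists_novak_step {α : Type} [TopologicalSpace α] [DiscreteTopology α]
    {S F : Set (StoneCech α)} (hSi : S.Infinite) (hS : #S ≤ 𝔠) (hF : #F ≤ 𝔠) :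
    ∃ G : Set (StoneCech α), ℵ₀ ≤ #G ∧ #G ≤ 𝔠 ∧ Disjoint G F ∧
      ∀ A ⊆ S, A.Infinite → ∃ x ∈ G, AccPt x (𝓟 A) := by
  classical
  -- Infinite rather than one-point choices, so that `ℵ₀ ≤ #G`; countable, so that the union over at
  -- most `𝔠` sequences keeps `#G ≤ 𝔠`.
  have hE : ∀ A : Set (StoneCech α), ∃ E ⊆ derivedSet A \ F, E.Countable ∧
      (A.Infinite → E.Infinite) := by
    intro A
    by_cases hA : A.Infinite
    · have hinf : (derivedSet A \ F).Infinite := by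
        intro hfin
        refine hA.continuum_lt_mk_derivedSet_stoneCech.not_ge ?_
        refine (Cardinal.mk_le_mk_of_subset (subset_sdiff_union (derivedSet A) F)).trans ?_
        refine (Cardinal.mk_union_le _ _).trans
          (Cardinal.add_le_of_le Cardinal.aleph0_le_continuum ?_ hF)
        exact hfin.countable.le_aleph0.trans Cardinal.aleph0_le_continuum
      refine ⟨range fun n => (Set.Infinite.natEmbedding _ hinf n : StoneCech α), ?_, countable_range _, fun _ => ?_⟩
      · rintro _ ⟨n, rfl⟩
        exact (Set.Infinite.natEmbedding _ hinf n).2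
      · exact infinite_range_of_injective
          (Subtype.val_injective.comp (Set.Infinite.natEmbedding _ hinf).injective)
    · exact ⟨∅, empty_subset _, countable_empty, fun h => (hA h).elim⟩
  choose E hEsub hEc hEi using hE
  let R : (ℕ → S) → Set (StoneCech α) := fun s => range fun n => (s n : StoneCech α)
  have hmem : ∀ A ⊆ S, A.Infinite → ∃ s : ℕ → S, R s ⊆ A ∧ (R s).Infinite := by
    intro A hAS hA
    refine ⟨fun n => ⟨Set.Infinite.natEmbedding _ hA n, hAS (Set.Infinite.natEmbedding _ hA n).2⟩, ?_, ?_⟩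
    · rintro _ ⟨n, rfl⟩
      exact (Set.Infinite.natEmbedding _ hA n).2
    · exact infinite_range_of_injective (f := fun n => (Set.Infinite.natEmbedding _ hA n : StoneCech α))
        (Subtype.val_injective.comp (Set.Infinite.natEmbedding _ hA).injective)
  refine ⟨⋃ s : ℕ → S, E (R s), ?_, ?_, ?_, ?_⟩
  · obtain ⟨s, -, hs⟩ := hmem S subset_rfl hSi
    have := ((hEi _ hs).mono (subset_iUnion (fun s => E (R s)) s)).to_subtype
    exact Cardinal.aleph0_le_mk _
  · refine (Cardinal.mk_iUnion_le _).trans ?_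
    have h1 : #(ℕ → S) ≤ 𝔠 := by
      simp only [Cardinal.mk_pi, Cardinal.prod_const, Cardinal.mk_nat, Cardinal.lift_id]
      exact (Cardinal.power_le_power_right hS).trans_eq Cardinal.continuum_power_aleph0
    have h2 : ⨆ s : ℕ → S, #(E (R s)) ≤ 𝔠 :=
      ciSup_le' fun s => (hEc _).le_aleph0.trans Cardinal.aleph0_le_continuum
    exact (mul_le_mul' h1 h2).trans_eq Cardinal.continuum_mul_self
  · exact disjoint_iUnion_left.2 fun s => disjoint_left.2 fun x hx => (hEsub _ hx).2
  · intro A hAS hA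
    obtain ⟨s, hsA, hs⟩ := hmem A hAS hA
    obtain ⟨x, hx⟩ := (hEi _ hs).nonempty
    exact ⟨x, mem_iUnion.2 ⟨s, hx⟩, derivedSet_mono _ _ hsA (hEsub _ hx).1⟩

/-! ### Stäckel-compactness of basic Novák spaces -/

/-- If every infinite closed set meets both `A` and its complement, then well-ordering `A`, and
putting the complement of `A` above it in a reversed well-order, gives a symmetric topological
well-order. -/
theorem exists_isSymmetricTopologicalWellOrder {X : Type*} [TopologicalSpace X] (A : Set X)
    (hA : ∀ C : Set X, IsClosed C → C.Infinite → (C ∩ A).Nonempty ∧ (C ∩ Aᶜ).Nonempty) :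
    ∃ o : LinearOrder X, IsSymmetricTopologicalWellOrder o := by
  classical
  obtain ⟨w, hw⟩ := exists_wellFoundedLT X
  let f : X → X ⊕ₗ Xᵒᵈ := fun x =>
    if x ∈ A then Sum.inlₗ x else Sum.inrₗ (OrderDual.toDual x)
  have hfA : ∀ x ∈ A, f x = Sum.inlₗ x := fun x hx => if_pos hx
  have hfB : ∀ x ∉ A, f x = Sum.inrₗ (OrderDual.toDual x) := fun x hx => if_neg hx
  have hf : Function.Injective f := by
    intro x y hxy
    by_cases hx : x ∈ A <;> by_cases hy : y ∈ A
    · rw [hfA x hx, hfA y hy] at hxy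
      exact Sum.inl_injective (toLex.injective hxy)
    · rw [hfA x hx, hfB y hy] at hxy
      exact (Sum.inl_ne_inr (toLex.injective hxy)).elim
    · rw [hfB x hx, hfA y hy] at hxy
      exact (Sum.inr_ne_inl (toLex.injective hxy)).elim
    · rw [hfB x hx, hfB y hy] at hxy
      exact OrderDual.toDual.injective (Sum.inr_injective (toLex.injective hxy))
  refine ⟨LinearOrder.lift' f hf, fun C hC hne => ?_⟩
  change (∃ a ∈ C, ∀ x ∈ C, f a ≤ f x) ∧ (∃ b ∈ C, ∀ x ∈ C, f x ≤ f b)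
  by_cases hfin : C.Finite
  · exact ⟨C.exists_min_image f hfin hne, C.exists_max_image f hfin hne⟩
  obtain ⟨h1, h2⟩ := hA C hC hfin
  constructor
  · obtain ⟨a, ha, hmin⟩ := WellFounded.has_min (wellFounded_lt (α := X)) _ h1
    refine ⟨a, ha.1, fun x hx => ?_⟩
    rw [hfA a ha.2]
    by_cases hxA : x ∈ A
    · rw [hfA x hxA]
      exact Sum.Lex.inl_le_inl_iff.2 (not_lt.1 (hmin x ⟨hx, hxA⟩))
    · rw [hfB x hxA]
      exact Sum.Lex.inl_le_inr _ _
  · obtain ⟨a, ha, hmin⟩ := WellFounded.has_min (wellFounded_lt (α := X)) _ h2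
    refine ⟨a, ha.1, fun x hx => ?_⟩
    rw [hfB a ha.2]
    by_cases hxA : x ∈ A
    · rw [hfA x hxA]
      exact Sum.Lex.inl_le_inr _ _
    · rw [hfB x hxA]
      exact Sum.Lex.inr_le_inr_iff.2 (OrderDual.toDual_le_toDual.2 (not_lt.1 (hmin x ⟨hx, hxA⟩)))

/-- Every basic Novák space is Stäckel-compact. -/
theorem IsBasicNovakSpace.stackelCompact {S : Set (StoneCech ℕ+)} (hS : IsBasicNovakSpace S) :
    StackelCompact S := by
  obtain ⟨X, rfl, hX⟩ := hS
  refine ⟨inferInstance, ?_⟩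
  have hmem : ∀ {ξ}, ξ < ω_ 1 → X ξ ⊆ ⋃ ξ < ω_ 1, X ξ := fun {ξ} hξ x hx =>
    mem_iUnion₂.2 ⟨ξ, hξ, hx⟩
  have hdisj : ∀ {μ ξ}, μ < ξ → ξ < ω_ 1 → ∀ x ∈ X μ, x ∉ X ξ := fun {μ ξ} h hξ x hx hx' =>
    disjoint_left.1 (hX ξ hξ).2.2.1 hx' (mem_iUnion₂.2 ⟨μ, h, hx⟩)
  have hmeet : ∀ C : Set ↥(⋃ ξ < ω_ 1, X ξ), IsClosed C → C.Infinite →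
      ∃ ζ < ω_ 1, ∀ ξ, ζ < ξ → ξ < ω_ 1 → ∃ x ∈ C, (x : StoneCech ℕ+) ∈ X ξ := by
    intro C hC hCi
    let c : ℕ → ↥(⋃ ξ < ω_ 1, X ξ) := fun n => Set.Infinite.natEmbedding C hCi n
    have hcC : ∀ n, c n ∈ C := fun n => (Set.Infinite.natEmbedding C hCi n).2
    choose ν hν hcν using fun n => mem_iUnion₂.1 (c n).2
    refine ⟨⨆ n, ν n, Ordinal.iSup_lt_omega_one hν, fun ξ hξ hξω => ?_⟩
    have hinf : (range fun n => (c n : StoneCech ℕ+)).Infinite :=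
      infinite_range_of_injective (Subtype.val_injective.comp
        (Subtype.val_injective.comp (Set.Infinite.natEmbedding C hCi).injective))
    obtain ⟨x, hx, hacc⟩ := (hX ξ hξω).2.2.2 (range fun n => (c n : StoneCech ℕ+))
      (by
        rintro _ ⟨n, rfl⟩
        exact mem_iUnion₂.2 ⟨ν n, (Ordinal.le_iSup ν n).trans_lt hξ, hcν n⟩) hinf
    refine ⟨⟨x, hmem hξω hx⟩, ?_, hx⟩
    rw [← hC.closure_eq, closure_subtype]
    refine closure_mono ?_ (derivedSet_subset_closure _ hacc)
    rintro _ ⟨n, rfl⟩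
    exact ⟨c n, hcC n, rfl⟩
  -- Beyond `ζ` there is a limit level, `ζ + ω`, and a successor level, `ζ + 1`.
  refine exists_isSymmetricTopologicalWellOrder
    {x | ∃ ξ < ω_ 1, Order.IsSuccLimit ξ ∧ (x : StoneCech ℕ+) ∈ X ξ} fun C hC hCi => ?_
  obtain ⟨ζ, hζ, h⟩ := hmeet C hC hCi
  constructor
  · have hlim : ζ + ω < ω_ 1 :=
      Ordinal.isPrincipal_add_omega 1 hζ Ordinal.omega0_lt_omega_one
    obtain ⟨x, hxC, hx⟩ := h (ζ + ω) (lt_add_of_pos_right ζ Ordinal.omega0_pos) hlim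
    exact ⟨x, hxC, ζ + ω, hlim, Ordinal.isSuccLimit_add ζ Ordinal.isSuccLimit_omega0, hx⟩
  · have hsucc : Order.succ ζ < ω_ 1 := (Cardinal.isSuccLimit_omega 1).succ_lt hζ
    obtain ⟨x, hxC, hx⟩ := h _ (Order.lt_succ ζ) hsucc
    refine ⟨x, hxC, ?_⟩
    rintro ⟨ξ, hξ, hlim, hxξ⟩
    rcases lt_trichotomy ξ (Order.succ ζ) with hlt | rfl | hlt
    · exact hdisj hlt hsucc _ hxξ hx
    · exact Order.not_isSuccLimit_succ ζ hlim
    · exact hdisj hlt hξ _ hx hxξ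

/-! ### Obstructions in the product -/

/-- In a countably compact space, a set all of whose subsets are closed is finite. -/
theorem Set.Finite.of_forall_subset_isClosed_of_countablyCompactSpace {X : Type*}
    [TopologicalSpace X] [CountablyCompactSpace X] {D : Set X} (hD : ∀ E ⊆ D, IsClosed E) :
    D.Finite := by
  by_contra hinf
  let d : ℕ → X := fun n => Set.Infinite.natEmbedding D hinf n
  have hd : Function.Injective d :=
    Subtype.val_injective.comp (Set.Infinite.natEmbedding D hinf).injective
  obtain ⟨a, -, ha⟩ := isCountablyCompact_iff_seq_clusterPt.1
    (CountablyCompactSpace.isCountablyCompact_univ (E := X)) d (.of_forall fun n => mem_univ _)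
  rw [mapClusterPt_atTop_iff_forall_mem_closure] at ha
  -- A cluster point lies in every tail, since tails are closed; injectivity forbids such
  -- repetition.
  have ha' : ∀ n, ∃ m ≥ n, d m = a := fun n => by
    have hcl : IsClosed (d '' Ici n) := hD _ <| by
      rintro _ ⟨m, -, rfl⟩
      exact (Set.Infinite.natEmbedding D hinf m).2
    have := ha n
    rw [hcl.closure_eq] at this
    exact this
  obtain ⟨m, -, hm⟩ := ha' 0
  obtain ⟨m', hm', h⟩ := ha' (m + 1)
  have := hd (hm.trans h.symm)
  omega

/-- In a Stäckel-compact space, a set all of whose subsets are closed is finite. -/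
theorem StackelCompact.finite_of_forall_subset_isClosed {X : Type*} [TopologicalSpace X]
    (hX : StackelCompact X) {D : Set X} (hD : ∀ E ⊆ D, IsClosed E) : D.Finite := by
  obtain ⟨-, o, ho⟩ := hX
  -- Every subset of `D` is closed, so `o` and its reverse both well-order `D`.
  have key : ∀ s : Set D, s.Nonempty → (∃ a ∈ s, ∀ x ∈ s, a ≤ x) ∧ (∃ b ∈ s, ∀ x ∈ s, x ≤ b) := by
    intro s hs
    obtain ⟨⟨a, ⟨a', ha', rfl⟩, ha⟩, ⟨b, ⟨b', hb', rfl⟩, hb⟩⟩ :=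
      ho (Subtype.val '' s) (hD _ (by rintro _ ⟨x, -, rfl⟩; exact x.2)) (hs.image _)
    exact ⟨⟨a', ha', fun x hx => ha x ⟨x, hx, rfl⟩⟩, ⟨b', hb', fun x hx => hb x ⟨x, hx, rfl⟩⟩⟩
  have : WellFoundedLT D := ⟨WellFounded.wellFounded_iff_has_min.2 fun s hs => by
    obtain ⟨a, ha, h⟩ := (key s hs).1
    exact ⟨a, ha, fun x hx => not_lt.2 (h x hx)⟩⟩
  have : WellFoundedGT D := ⟨WellFounded.wellFounded_iff_has_min.2 fun s hs => by
    obtain ⟨a, ha, h⟩ := (key s hs).2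
    exact ⟨a, ha, fun x hx => not_lt.2 (h x hx)⟩⟩
  have : Finite D := Finite.of_wellFoundedLT_wellFoundedGT D
  exact Set.toFinite D

/-- The points of a discrete space are isolated in its Stone-Čech compactification. -/
theorem isOpen_singleton_stoneCechUnit {α : Type*} [TopologicalSpace α] [DiscreteTopology α]
    (a : α) : IsOpen {(stoneCechUnit a : StoneCech α)} := by
  classical
  have hg : Continuous fun k : α => decide (k = a) := continuous_of_discreteTopology
  have hO : IsOpen (stoneCechExtend hg ⁻¹' {true}) :=
    (isOpen_discrete _).preimage (continuous_stoneCechExtend hg)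
  convert hO
  refine Subset.antisymm (by simp) ?_
  refine (denseRange_stoneCechUnit.open_subset_closure_inter hO).trans
    (closure_minimal ?_ isClosed_singleton)
  rintro _ ⟨hx, k, rfl⟩
  simp only [mem_preimage, stoneCechExtend_stoneCechUnit, mem_singleton_iff, decide_eq_true_eq] at hx
  simp [hx]

/-- If the only common points of `Y` and `Z` are isolated, every set of diagonal points
is closed in `Y × Z`. -/
theorem isClosed_of_subset_diagonal {X : Type*} [TopologicalSpace X] [T2Space X] {Y Z : Set X}
    (hYZ : ∀ x ∈ Y, x ∈ Z → IsOpen {x}) {E : Set (Y × Z)} (hE : ∀ p ∈ E, (p.1 : X) = p.2) :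
    IsClosed E := by
  refine isClosed_of_closure_subset fun p hp => ?_
  have hcl : IsClosed {p : Y × Z | (p.1 : X) = p.2} := isClosed_eq (by fun_prop) (by fun_prop)
  have hpd : (p.1 : X) = p.2 := closure_minimal hE hcl hp
  -- The limit `p` is diagonal, so its coordinate is a common, hence isolated, point; `E` then has a
  -- point with that coordinate, necessarily `p`.
  have hiso : IsOpen {(p.1 : X)} := hYZ _ p.1.2 (by rw [hpd]; exact p.2.2)
  have hO : IsOpen {q : Y × Z | (q.1 : X) ∈ ({(p.1 : X)} : Set X)} := hiso.preimage (by fun_prop)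
  obtain ⟨q, hq, hqE⟩ := mem_closure_iff.1 hp _ hO rfl
  have hq1 : (q.1 : X) = p.1 := hq
  have hqp : q = p := Prod.ext (Subtype.ext hq1) (Subtype.ext (by rw [← hE q hqE, hq1, hpd]))
  rwa [← hqp]

/-! ### The joint transfinite construction -/

/-- An initial segment of length less than `ω₁` of sets with at most continuum many elements has
a union with at most continuum many elements. -/
theorem mk_biUnion_lt_le_continuum {α : Type} {X : Ordinal.{0} → Set α} {ξ : Ordinal.{0}}
    (hξ : ξ < ω_ 1) (hX : ∀ μ < ξ, #(X μ) ≤ 𝔠) : #(⋃ μ < ξ, X μ : Set α) ≤ 𝔠 := by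
  have h := Cardinal.mk_biUnion_le_lift X (Iio ξ)
  have h1 : Cardinal.lift.{0} #(Iio ξ) ≤ 𝔠 := by
    rw [Cardinal.mk_Iio_ordinal, Cardinal.lift_lift, Cardinal.lift_le_continuum]
    refine le_trans ?_ Cardinal.aleph0_le_continuum
    rw [← Cardinal.lt_aleph_one_iff, ← Cardinal.lt_ord, Cardinal.ord_aleph]
    exact hξ
  have h2 : ⨆ μ : Iio ξ, Cardinal.lift.{1} #(X μ.1) ≤ 𝔠 :=
    ciSup_le' fun μ => Cardinal.lift_le_continuum.2 (hX μ.1 μ.2)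
  exact Cardinal.lift_le_continuum.1
    (h.trans ((mul_le_mul' h1 h2).trans_eq Cardinal.continuum_mul_self))

/-- Two basic Novák spaces whose only common points are those of the discrete space. -/
theorem exists_isBasicNovakSpace_pair :
    ∃ Y Z : Set (StoneCech ℕ+), IsBasicNovakSpace Y ∧ IsBasicNovakSpace Z ∧
      Y ∩ Z = range stoneCechUnit := by
  classical
  -- Moving the hypotheses inside makes `G` total, so the recursion can be defined before the
  -- cardinal bounds are known.
  have hstep : ∀ S F : Set (StoneCech ℕ+), ∃ G : Set (StoneCech ℕ+),
      S.Infinite → #S ≤ 𝔠 → #F ≤ 𝔠 → ℵ₀ ≤ #G ∧ #G ≤ 𝔠 ∧ Disjoint G F ∧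
        ∀ A ⊆ S, A.Infinite → ∃ x ∈ G, AccPt x (𝓟 A) := by
    intro S F
    by_cases h : S.Infinite ∧ #S ≤ 𝔠 ∧ #F ≤ 𝔠
    · obtain ⟨G, hG⟩ := exists_novak_step h.1 h.2.1 h.2.2
      exact ⟨G, fun _ _ _ => hG⟩
    · exact ⟨∅, fun h1 h2 h3 => (h ⟨h1, h2, h3⟩).elim⟩
  choose G hG using hstep
  let N : Set (StoneCech ℕ+) := range stoneCechUnit
  -- The second component also avoids the points just added to the first, which settles the case of
  -- equal levels.
  let next : Set (StoneCech ℕ+) → Set (StoneCech ℕ+) → Set (StoneCech ℕ+) × Set (StoneCech ℕ+) :=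
    fun S T => (G S (S ∪ T), G T (S ∪ T ∪ G S (S ∪ T)))
  let P : Ordinal.{0} → Set (StoneCech ℕ+) × Set (StoneCech ℕ+) :=
    WellFounded.fix (wellFounded_lt (α := Ordinal.{0})) fun ξ P =>
      if ξ = 0 then (N, N) else
        next (⋃ (μ : Ordinal.{0}) (h : μ < ξ), (P μ h).1) (⋃ (μ : Ordinal.{0}) (h : μ < ξ), (P μ h).2)
  have hP : ∀ ξ, P ξ = if ξ = 0 then (N, N) else
      next (⋃ μ < ξ, (P μ).1) (⋃ μ < ξ, (P μ).2) := fun ξ => WellFounded.fix_eq _ _ ξ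
  clear_value P
  have hP0 : P 0 = (N, N) := by rw [hP, if_pos rfl]
  let S : Ordinal.{0} → Set (StoneCech ℕ+) := fun ξ => ⋃ μ < ξ, (P μ).1
  let T : Ordinal.{0} → Set (StoneCech ℕ+) := fun ξ => ⋃ μ < ξ, (P μ).2
  have hP1 : ∀ ξ, ξ ≠ 0 → (P ξ).1 = G (S ξ) (S ξ ∪ T ξ) := fun ξ h => by rw [hP, if_neg h]
  have hP2 : ∀ ξ, ξ ≠ 0 → (P ξ).2 = G (T ξ) (S ξ ∪ T ξ ∪ (P ξ).1) := fun ξ h => by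
    rw [hP1 ξ h, hP, if_neg h]
  have hNi : N.Infinite := infinite_range_of_injective injective_stoneCechUnit_of_t35Space
  have hNc : #N ≤ ℵ₀ := (countable_range _).le_aleph0
  have hNS : ∀ ξ, ξ ≠ 0 → N ⊆ S ξ := fun ξ h x hx =>
    mem_iUnion₂.2 ⟨0, pos_iff_ne_zero.2 h, by rwa [hP0]⟩
  have hNT : ∀ ξ, ξ ≠ 0 → N ⊆ T ξ := fun ξ h x hx =>
    mem_iUnion₂.2 ⟨0, pos_iff_ne_zero.2 h, by rwa [hP0]⟩
  have hunion : ∀ {A B : Set (StoneCech ℕ+)}, #A ≤ 𝔠 → #B ≤ 𝔠 → #(A ∪ B : Set _) ≤ 𝔠 :=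
    fun hA hB => (Cardinal.mk_union_le _ _).trans
      (Cardinal.add_le_of_le Cardinal.aleph0_le_continuum hA hB)
  have hcard : ∀ ξ < ω_ 1, #(P ξ).1 ≤ 𝔠 ∧ #(P ξ).2 ≤ 𝔠 := by
    intro ξ
    induction ξ using WellFoundedLT.induction with
    | ind ξ ih =>
    intro hξ
    by_cases h0 : ξ = 0
    · subst h0
      rw [hP0]
      exact ⟨hNc.trans Cardinal.aleph0_le_continuum, hNc.trans Cardinal.aleph0_le_continuum⟩
    have hS : #(S ξ) ≤ 𝔠 := mk_biUnion_lt_le_continuum hξ fun μ hμ => (ih μ hμ (hμ.trans hξ)).1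
    have hT : #(T ξ) ≤ 𝔠 := mk_biUnion_lt_le_continuum hξ fun μ hμ => (ih μ hμ (hμ.trans hξ)).2
    have h1 : #(P ξ).1 ≤ 𝔠 := by
      rw [hP1 ξ h0]
      exact (hG _ _ (hNi.mono (hNS ξ h0)) hS (hunion hS hT)).2.1
    refine ⟨h1, ?_⟩
    rw [hP2 ξ h0]
    exact (hG _ _ (hNi.mono (hNT ξ h0)) hT (hunion (hunion hS hT) h1)).2.1
  have hS : ∀ ξ < ω_ 1, #(S ξ) ≤ 𝔠 := fun ξ hξ =>
    mk_biUnion_lt_le_continuum hξ fun μ hμ => (hcard μ (hμ.trans hξ)).1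
  have hT : ∀ ξ < ω_ 1, #(T ξ) ≤ 𝔠 := fun ξ hξ =>
    mk_biUnion_lt_le_continuum hξ fun μ hμ => (hcard μ (hμ.trans hξ)).2
  have hY : ∀ ξ < ω_ 1, ξ ≠ 0 → ℵ₀ ≤ #(P ξ).1 ∧ #(P ξ).1 ≤ 𝔠 ∧ Disjoint (P ξ).1 (S ξ ∪ T ξ) ∧
      ∀ A ⊆ S ξ, A.Infinite → ∃ x ∈ (P ξ).1, AccPt x (𝓟 A) := fun ξ hξ h0 => by
    rw [hP1 ξ h0]
    exact hG _ _ (hNi.mono (hNS ξ h0)) (hS ξ hξ) (hunion (hS ξ hξ) (hT ξ hξ))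
  have hZ : ∀ ξ < ω_ 1, ξ ≠ 0 → ℵ₀ ≤ #(P ξ).2 ∧ #(P ξ).2 ≤ 𝔠 ∧
      Disjoint (P ξ).2 (S ξ ∪ T ξ ∪ (P ξ).1) ∧
      ∀ A ⊆ T ξ, A.Infinite → ∃ x ∈ (P ξ).2, AccPt x (𝓟 A) := fun ξ hξ h0 => by
    rw [hP2 ξ h0]
    exact hG _ _ (hNi.mono (hNT ξ h0)) (hT ξ hξ)
      (hunion (hunion (hS ξ hξ) (hT ξ hξ)) (hcard ξ hξ).1)
  have hNaleph : ℵ₀ ≤ #N := by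
    have := hNi.to_subtype
    exact Cardinal.aleph0_le_mk _
  have h0ω : (0 : Ordinal.{0}) < ω_ 1 := Ordinal.omega_pos 1
  refine ⟨⋃ ξ < ω_ 1, (P ξ).1, ⋃ ξ < ω_ 1, (P ξ).2, ⟨fun ξ => (P ξ).1, rfl, fun ξ hξ => ?_⟩,
    ⟨fun ξ => (P ξ).2, rfl, fun ξ hξ => ?_⟩, ?_⟩
  · rw [Cardinal.two_power_aleph0]
    by_cases h0 : ξ = 0
    · subst h0
      simp only [hP0, not_lt_zero, iUnion_of_empty, iUnion_empty, subset_empty_iff]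
      exact ⟨hNaleph, hNc.trans Cardinal.aleph0_le_continuum, disjoint_empty _,
        fun A hA hAi => (hAi.nonempty.ne_empty hA).elim⟩
    · obtain ⟨h1, h2, h3, h4⟩ := hY ξ hξ h0
      exact ⟨h1, h2, h3.mono_right subset_union_left, h4⟩
  · rw [Cardinal.two_power_aleph0]
    by_cases h0 : ξ = 0
    · subst h0
      simp only [hP0, not_lt_zero, iUnion_of_empty, iUnion_empty, subset_empty_iff]
      exact ⟨hNaleph, hNc.trans Cardinal.aleph0_le_continuum, disjoint_empty _,
        fun A hA hAi => (hAi.nonempty.ne_empty hA).elim⟩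
    · obtain ⟨h1, h2, h3, h4⟩ := hZ ξ hξ h0
      exact ⟨h1, h2, h3.mono_right (subset_union_right.trans subset_union_left), h4⟩
  · refine Subset.antisymm ?_ fun x hx =>
      ⟨mem_iUnion₂.2 ⟨0, h0ω, by rwa [hP0]⟩, mem_iUnion₂.2 ⟨0, h0ω, by rwa [hP0]⟩⟩
    rintro x ⟨hxY, hxZ⟩
    obtain ⟨ξ, hξ, hxξ⟩ := mem_iUnion₂.1 hxY
    obtain ⟨ζ, hζ, hxζ⟩ := mem_iUnion₂.1 hxZ
    by_cases hξ0 : ξ = 0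
    · rwa [hξ0, hP0] at hxξ
    by_cases hζ0 : ζ = 0
    · rwa [hζ0, hP0] at hxζ
    exfalso
    rcases lt_or_ge ζ ξ with h | h
    · exact disjoint_left.1 (hY ξ hξ hξ0).2.2.1 hxξ (Or.inr (mem_iUnion₂.2 ⟨ζ, h, hxζ⟩))
    · refine disjoint_left.1 (hZ ζ hζ hζ0).2.2.1 hxζ ?_
      rcases h.lt_or_eq with h | rfl
      · exact Or.inl (Or.inl (mem_iUnion₂.2 ⟨ξ, h, hxξ⟩))
      · exact Or.inr hxξ

theorem mainTheorem8 :
    ∃ Y Z : Set (StoneCech ℕ+),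
      IsBasicNovakSpace Y ∧ IsBasicNovakSpace Z ∧
      StackelCompact Y ∧ StackelCompact Z ∧
      ¬ CountablyCompactSpace (Y × Z) ∧ ¬ StackelCompact (Y × Z) := by
  obtain ⟨Y, Z, hY, hZ, hYZ⟩ := exists_isBasicNovakSpace_pair
  have hiso : ∀ x ∈ Y, x ∈ Z → IsOpen {x} := fun x hxY hxZ => by
    obtain ⟨n, rfl⟩ : x ∈ range stoneCechUnit := hYZ ▸ ⟨hxY, hxZ⟩
    exact isOpen_singleton_stoneCechUnit n
  let D : Set (Y × Z) := {p | (p.1 : StoneCech ℕ+) = p.2}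
  have hD : ∀ E ⊆ D, IsClosed E := fun E hE => isClosed_of_subset_diagonal hiso hE
  -- The common points embed diagonally, so `D` is infinite.
  have hmem : ∀ n : ℕ+, (stoneCechUnit n : StoneCech ℕ+) ∈ Y ∩ Z := fun n =>
    hYZ ▸ mem_range_self n
  have hinf : D.Infinite := by
    refine infinite_of_injective_forall_mem
      (f := fun n : ℕ+ => ((⟨_, (hmem n).1⟩, ⟨_, (hmem n).2⟩) : Y × Z)) ?_ fun n => rfl
    intro m n h
    exact injective_stoneCechUnit_of_t35Space (congrArg (fun p : Y × Z => (p.1 : StoneCech ℕ+)) h)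
  exact ⟨Y, Z, hY, hZ, hY.stackelCompact, hZ.stackelCompact,
    fun _ => hinf (.of_forall_subset_isClosed_of_countablyCompactSpace hD),
    fun h => hinf (h.finite_of_forall_subset_isClosed hD)⟩
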